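/- Let $\mu=\mu_{\frac14}$ be the $\frac14$ Cantor measure on $\mathbb{R}$, that is, the distribution of $\sum_{k\ge 1} d_k 4^{-k}$ with independent digits $d_k$, each equal to $0$ or $2$ with probability $\frac12$. Write $e_n(t)=e^{2\pi i n t}$ for $n\in\mathbb{Z}$, and let $\Gamma=\{\sum_{i=0}^m a_i4^i : m\ge 0,\ a_i\in\{0,1\}\}=\{0,1,4,5,16,17,20,\dots\}$. Consider the following relations for bounded operators $S_0,S_1,U,M$ on a complex Hilbert space: $S_0,S_1$ form a representation of the Cuntz algebra $\mathcal{O}_2$, i.e. $S_i^*S_j=\delta_{i,j}I$ for $i,j\in\{0,1\}$ and $S_0S_0^*+S_1S_1^*=I$; $U$ is normal; $M$ is unitary; $S_1^*US_1=MU$; and $S_0U=US_0$. Theorem. These relations have an irreducible representation on $L^2(\mu_{\frac14})$. Namely, there are bounded operators $S_0,S_1,U,M$ on $L^2(\mu_{\frac14})$ such that $$S_0e_\gamma=e_{4\gamma},\qquad S_1e_\gamma=e_{4\gamma+1},\qquad Ue_\gamma=e_{5\gamma}\qquad(\gamma\in\Gamma),$$ $U$ is unitary, and $M$ is multiplication by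 the function $e_1$; these operators satisfy all the relations above; and the only closed subspaces of the nonzero space $L^2(\mu_{\frac14})$ that are invariant under $S_0,S_1,U,M$ and their adjoints are $\{0\}$ and $L^2(\mu_{\frac14})$. -/

import Mathlib

open MeasureTheory

noncomputable section

namespace OperatorFractal

section Relations

variable (H : Type*) [NormedAddCommGroup H] [InnerProductSpace ℂ H] [CompleteSpace H]

/-- A representation on the Hilbert space `H` of the generators and relations under study:
bounded operators `S₀, S₁` forming a representation of the Cuntz algebra `𝒪₂`, a normal
operator `U`, a unitary operator `M`, with `S₁* U S₁ = M U` and `S₀ U = U S₀`.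
Here `star` is the Hilbert space adjoint and `*` is composition of operators. -/
structure Rep where
  /-- the Cuntz operators `S₀, S₁` -/
  S : Fin 2 → (H →L[ℂ] H)
  /-- the normal operator -/
  U : H →L[ℂ] H
  /-- the unitary operator -/
  M : H →L[ℂ] H
  star_S_mul_S : ∀ i j : Fin 2, star (S i) * S j = if i = j then 1 else 0
  sum_S_mul_star_S : ∑ i : Fin 2, S i * star (S i) = 1
  isStarNormal_U : IsStarNormal U
  unitary_M : M ∈ unitary (H →L[ℂ] H)
  star_S_one_mul_U_mul_S_one : star (S 1) * U * S 1 = M * U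
  commute_S_zero_U : Commute (S 0) U

variable {H}

/-- The four generating operators `S₀, S₁, U, M` of a representation. -/
def Rep.generators (π : Rep H) : Set (H →L[ℂ] H) := {π.S 0, π.S 1, π.U, π.M}

/-- The representation is irreducible: the space is nonzero, and the only closed subspaces that
are invariant under all the generating operators and their adjoints are `0` and the whole space. -/
def Rep.IsIrreducible (π : Rep H) : Prop :=
  Nontrivial H ∧
    ∀ K : Submodule ℂ H, IsClosed (K : Set H) →
      (∀ T ∈ π.generators, ∀ x ∈ K, T x ∈ K ∧ star T x ∈ K) → K = ⊥ ∨ K = ⊤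

end Relations

section CantorMeasure

/-- The law of a fair coin. -/
def fairCoin : Measure Bool := (PMF.uniformOfFintype Bool).toMeasure

instance : IsProbabilityMeasure fairCoin := by
  unfold fairCoin; infer_instance

/-- The point `∑ₖ dₖ / 4ᵏ⁺¹`, `dₖ ∈ {0, 2}`, of the Cantor set of the contractions
`x ↦ x / 4` and `x ↦ (x + 2) / 4` that has the binary sequence `ω` as its address. -/
def cantorPoint (ω : ℕ → Bool) : ℝ := ∑' k : ℕ, (if ω k then 2 else 0) / 4 ^ (k + 1)

lemma continuous_cantorPoint : Continuous cantorPoint := by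
  unfold cantorPoint
  refine continuous_tsum (u := fun k : ℕ => 2 * (1 / 4 : ℝ) ^ k) (fun k => ?_)
    ((summable_geometric_of_lt_one (by norm_num) (by norm_num)).mul_left 2) (fun k ω => ?_)
  · exact (continuous_of_discreteTopology
      (f := fun b : Bool => (if b then (2 : ℝ) else 0) / 4 ^ (k + 1))).comp (continuous_apply k)
  · have h4 : (0 : ℝ) < 4 ^ k := by positivity
    rw [Real.norm_eq_abs, one_div, inv_pow, ← div_eq_mul_inv]
    split_ifs
    · rw [abs_of_nonneg (by positivity), pow_succ]
      gcongr
      linarith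
    · rw [zero_div, abs_zero]
      positivity

/-- The `1/4` Cantor measure `μ_{1/4}`: the law of `∑ₖ dₖ / 4ᵏ⁺¹` for independent digits `dₖ`, each
equal to `0` or `2` with probability `1/2`; equivalently the probability measure that is invariant
under the contractions `x ↦ x / 4` and `x ↦ (x + 2) / 4` taken with equal weights. -/
def cantorMeasure : Measure ℝ :=
  (Measure.infinitePi fun _ : ℕ => fairCoin).map cantorPoint

instance : IsProbabilityMeasure cantorMeasure :=
  Measure.isProbabilityMeasure_map continuous_cantorPoint.measurable.aemeasurable

/-- The complex Hilbert space `L²(μ_{1/4})`. -/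
abbrev L2Cantor : Type := Lp ℂ 2 cantorMeasure

/-- The exponential function `t ↦ e^{2πi n t}`. -/
def expFun (n : ℤ) (t : ℝ) : ℂ := Complex.exp (2 * Real.pi * Complex.I * n * t)

lemma memLp_expFun (n : ℤ) : MemLp (expFun n) 2 cantorMeasure := by
  refine MemLp.of_bound (C := 1) ?_ (Filter.Eventually.of_forall fun t => ?_)
  · unfold expFun
    exact Continuous.aestronglyMeasurable (by fun_prop)
  · have h : 2 * (Real.pi : ℂ) * Complex.I * n * t
        = ((2 * Real.pi * n * t : ℝ) : ℂ) * Complex.I := by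
      push_cast; ring
    rw [expFun, h, Complex.norm_exp_ofReal_mul_I]

/-- The exponential `e_n(t) = e^{2πi n t}` as a vector of `L²(μ_{1/4})`. -/
def e (n : ℤ) : L2Cantor := (memLp_expFun n).toLp (expFun n)

/-- The set `Γ(1/4) = {∑_{i ≤ m} aᵢ 4ⁱ : aᵢ ∈ {0, 1}} = {0, 1, 4, 5, 16, 17, 20, …}`. -/
def Γ : Set ℤ :=
  {γ | ∃ (m : ℕ) (a : ℕ → ℤ), (∀ i, a i = 0 ∨ a i = 1) ∧
    γ = ∑ i ∈ Finset.range (m + 1), a i * 4 ^ i}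

end CantorMeasure

end OperatorFractal

end

/-! Let `σ` be the expansive map of the Cantor set, `S₀ f = f ∘ σ` and `S₁ f = e₁ · (f ∘ σ)`.
Flipping the first digit preserves the measure, fixes `f ∘ σ` and changes the sign of `e_p` for odd
`p`; hence `S₀` and `e_p · S₀` are isometries with orthogonal ranges (`inner_compDilate_mulExp`).

The main point is that the exponentials over `Γ` and over `5Γ` are both orthonormal bases; `U` is
then the unitary that carries one to the other. Orthonormality follows from `Γ = 4Γ ⊔ (4Γ + 1)`. For
completeness, let `P` project onto the closed span over `pΓ` and put `Q t = ‖P e_t‖²`. The span and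
its complement are invariant under `S₀` and `e_p · S₀`, so the decomposition `eR_eq_add` of `e_t`
yields `Q t = cos²(πt/2) Q(t/4) + sin²(πt/2) Q((t-p)/4)`. A minimum argument (`eq_one_of_two_scale`)
forces `Q = 1`, and the `e_t` with real `t` are total by uniqueness of characteristic functions. The
relations then reduce to integer identities between frequencies.

For irreducibility, let `K` be a reducing subspace. The projection of `e₀` to `K` is fixed by `S₀`,
hence a multiple of `e₀` by ergodicity. So `e₀` lies in `K` or in `Kᗮ`, and powers of `M` then
produce every `e_n` with `n ≥ 0`. -/

noncomputable section

namespace OperatorFractal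

/-! ### Self-similarity of the Cantor measure: shift and first-digit flip. -/

section SelfSimilarity

/-- The left shift of binary sequences. -/
def shift (ω : ℕ → Bool) : ℕ → Bool := fun k => ω (k + 1)

/-- Flip the first letter of a binary sequence. -/
def flipFirst (ω : ℕ → Bool) : ℕ → Bool := fun k => if k = 0 then !(ω k) else ω k

lemma measurable_shift : Measurable shift :=
  measurable_pi_lambda _ fun k => measurable_pi_apply (k + 1)

lemma measurable_flipFirst : Measurable flipFirst :=
  measurable_pi_lambda _ fun k => by
    by_cases hk : k = 0
    · subst hk
      exact (measurable_of_finite not).comp (measurable_pi_apply 0)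
    · simpa only [flipFirst, if_neg hk] using measurable_pi_apply k

lemma map_not_fairCoin : fairCoin.map not = fairCoin := by
  refine Measure.ext_of_singleton fun b => ?_
  rw [Measure.map_apply (measurable_of_finite _) (measurableSet_singleton b)]
  have h : (not ⁻¹' {b} : Set Bool) = {!b} := by
    ext x; cases x <;> cases b <;> simp
  rw [h, fairCoin, PMF.toMeasure_apply_singleton _ _ (measurableSet_singleton _),
    PMF.toMeasure_apply_singleton _ _ (measurableSet_singleton _)]
  simp

lemma map_shift : (Measure.infinitePi fun _ : ℕ => fairCoin).map shift
    = Measure.infinitePi fun _ : ℕ => fairCoin :=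
  Measure.map_infinitePi_infinitePi_of_inj (P := fun _ : ℕ => fairCoin) (add_left_injective 1)

lemma map_flipFirst : (Measure.infinitePi fun _ : ℕ => fairCoin).map flipFirst
    = Measure.infinitePi fun _ : ℕ => fairCoin := by
  have h := Measure.infinitePi_map_pi (fun _ : ℕ => fairCoin)
    (f := fun k b => if k = 0 then !b else b) (fun k => measurable_of_finite _)
  refine h.trans ?_
  congr 1
  funext k
  by_cases hk : k = 0
  · simpa [hk] using map_not_fairCoin
  · simp [hk]

lemma summable_digits (ω : ℕ → Bool) :
    Summable fun k : ℕ => (if ω k then (2 : ℝ) else 0) / 4 ^ (k + 1) := by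
  refine Summable.of_nonneg_of_le (fun k => by split_ifs <;> positivity) (fun k => ?_)
    ((summable_geometric_of_lt_one (r := (1 / 4 : ℝ)) (by norm_num) (by norm_num)).mul_left
      (1 / 2))
  rw [one_div_pow, pow_succ]
  have h4 : (0 : ℝ) < 4 ^ k := by positivity
  split_ifs
  · apply le_of_eq; field_simp; norm_num
  · rw [zero_div]; positivity

lemma cantorPoint_nonneg (ω : ℕ → Bool) : 0 ≤ cantorPoint ω :=
  tsum_nonneg fun k => by split_ifs <;> positivity

lemma cantorPoint_le (ω : ℕ → Bool) : cantorPoint ω ≤ 2 / 3 := by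
  have hs := (summable_geometric_of_lt_one (r := (1 / 4 : ℝ)) (by norm_num)
    (by norm_num)).mul_left (1 / 2)
  have h := (summable_digits ω).tsum_le_tsum (fun k => ?_) hs
  · rw [tsum_mul_left, tsum_geometric_of_lt_one (by norm_num) (by norm_num)] at h
    exact h.trans (by norm_num)
  · rw [one_div_pow, pow_succ]
    have h4 : (0 : ℝ) < 4 ^ k := by positivity
    split_ifs
    · apply le_of_eq; field_simp; norm_num
    · rw [zero_div]; positivity

lemma cantorPoint_eq (ω : ℕ → Bool) :
    cantorPoint ω = (if ω 0 then 1 else 0) / 2 + cantorPoint (shift ω) / 4 := by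
  rw [cantorPoint, (summable_digits ω).tsum_eq_zero_add, cantorPoint, ← tsum_div_const]
  congr 1
  · split_ifs <;> norm_num
  · refine tsum_congr fun k => ?_
    rw [div_div, ← pow_succ]
    rfl

/-- The tail contributes at most `1/3` to `2 * cantorPoint ω`, so the first digit can be read off
the point. This makes shift and flip into maps of the line. -/
lemma floor_two_mul_cantorPoint (ω : ℕ → Bool) :
    ⌊2 * cantorPoint ω⌋ = if ω 0 then 1 else 0 := by
  have h0 := cantorPoint_nonneg (shift ω)
  have h1 := cantorPoint_le (shift ω)
  rw [Int.floor_eq_iff, cantorPoint_eq ω]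
  split_ifs <;> constructor <;> push_cast <;> linarith

/-- The expansive map of the iterated function system `x ↦ x / 4`, `x ↦ (x + 2) / 4`. -/
def dilate (x : ℝ) : ℝ := 2 * Int.fract (2 * x)

/-- Exchange of the two halves of `[0, 1)`. -/
def swap (x : ℝ) : ℝ := if x < 1 / 2 then x + 1 / 2 else x - 1 / 2

lemma measurable_dilate : Measurable dilate := by
  unfold dilate
  exact (measurable_fract.comp (measurable_const.mul measurable_id)).const_mul 2

lemma measurable_swap : Measurable swap :=
  Measurable.ite measurableSet_Iio (measurable_id.add_const _) (measurable_id.sub_const _)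

lemma dilate_cantorPoint (ω : ℕ → Bool) : dilate (cantorPoint ω) = cantorPoint (shift ω) := by
  rw [dilate, Int.fract, floor_two_mul_cantorPoint, cantorPoint_eq ω]
  split_ifs <;> push_cast <;> ring

lemma swap_cantorPoint (ω : ℕ → Bool) : swap (cantorPoint ω) = cantorPoint (flipFirst ω) := by
  have hs : shift (flipFirst ω) = shift ω := by
    funext k; simp [shift, flipFirst]
  have hz : flipFirst ω 0 = !(ω 0) := by simp [flipFirst]
  have h0 := cantorPoint_nonneg (shift ω)
  have h1 := cantorPoint_le (shift ω)
  rw [cantorPoint_eq (flipFirst ω), hs, hz, cantorPoint_eq ω, swap]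
  cases ω 0
  · rw [if_pos (by norm_num; linarith)]; norm_num; ring
  · rw [if_neg (by norm_num; linarith)]; norm_num

/-- Transports invariance from coin tosses to the line; `T` matters only on the Cantor set. -/
lemma measurePreserving_of_conj {T : ℝ → ℝ} {τ : (ℕ → Bool) → ℕ → Bool} (hT : Measurable T)
    (hτ : Measurable τ) (h : ∀ ω, T (cantorPoint ω) = cantorPoint (τ ω))
    (hmap : (Measure.infinitePi fun _ : ℕ => fairCoin).map τ
      = Measure.infinitePi fun _ : ℕ => fairCoin) :
    MeasurePreserving T cantorMeasure cantorMeasure := by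
  refine ⟨hT, ?_⟩
  rw [cantorMeasure, Measure.map_map hT continuous_cantorPoint.measurable]
  have : T ∘ cantorPoint = cantorPoint ∘ τ := funext h
  rw [this, ← Measure.map_map continuous_cantorPoint.measurable hτ, hmap]

lemma measurePreserving_dilate : MeasurePreserving dilate cantorMeasure cantorMeasure :=
  measurePreserving_of_conj measurable_dilate measurable_shift dilate_cantorPoint map_shift

lemma measurePreserving_swap : MeasurePreserving swap cantorMeasure cantorMeasure :=
  measurePreserving_of_conj measurable_swap measurable_flipFirst swap_cantorPoint map_flipFirst

lemma ae_mem_Ico : ∀ᵐ x ∂cantorMeasure, x ∈ Set.Ico (0 : ℝ) 1 := by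
  rw [cantorMeasure, ae_map_iff (p := fun x => x ∈ Set.Ico (0 : ℝ) 1)
    continuous_cantorPoint.measurable.aemeasurable measurableSet_Ico]
  exact Filter.Eventually.of_forall fun ω =>
    ⟨cantorPoint_nonneg ω, (cantorPoint_le ω).trans_lt (by norm_num)⟩

lemma dilate_swap (x : ℝ) : dilate (swap x) = dilate x := by
  have h1 : 2 * (x + 1 / 2) = 2 * x + (1 : ℤ) := by push_cast; ring
  have h2 : 2 * (x - 1 / 2) = 2 * x - (1 : ℤ) := by push_cast; ring
  unfold dilate swap
  split_ifs
  · rw [h1, Int.fract_add_intCast]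
  · rw [h2, Int.fract_sub_intCast]

end SelfSimilarity

/-! ### Fourier uniqueness for integrable functions. -/

section Totality

/-- The positive and negative parts of `g` are densities of two finite measures with equal
characteristic functions, so they agree almost everywhere. -/
lemma eq_zero_of_forall_integral_mul_exp_real {μ : Measure ℝ} {g : ℝ → ℝ} (hg : Integrable g μ)
    (h : ∀ t : ℝ, ∫ x, (g x : ℂ) * Complex.exp (t * x * Complex.I) ∂μ = 0) : g =ᵐ[μ] 0 := by
  have hm := hg.aestronglyMeasurable.aemeasurable
  let ν (f : ℝ → ℝ) : Measure ℝ := μ.withDensity fun x => ENNReal.ofReal (f x)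
  have hfin (f : ℝ → ℝ) (hf : Integrable f μ) : IsFiniteMeasure (ν f) :=
    isFiniteMeasure_withDensity_ofReal hf.2
  have h1 := hfin g hg
  have h2 := hfin (fun x => -g x) hg.neg
  have hchar (f : ℝ → ℝ) (hf : Integrable f μ) (t : ℝ) :
      charFun (ν f) t = ∫ x, (max (f x) 0 : ℝ) * Complex.exp (t * x * Complex.I) ∂μ := by
    rw [charFun_apply_real, integral_withDensity_eq_integral_toReal_smul₀
      hf.aestronglyMeasurable.aemeasurable.ennreal_ofReal (by simp)]
    refine integral_congr_ae (Filter.Eventually.of_forall fun x => ?_)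
    simp [ENNReal.toReal_ofReal', Complex.real_smul]
  have hint (f : ℝ → ℝ) (hf : Integrable f μ) (t : ℝ) :
      Integrable (fun x => ((max (f x) 0 : ℝ) : ℂ) * Complex.exp (t * x * Complex.I)) μ := by
    refine (hf.pos_part.ofReal (𝕜 := ℂ)).mul_bdd (c := 1)
      (Continuous.aestronglyMeasurable (by fun_prop)) (Filter.Eventually.of_forall fun x => ?_)
    rw [← Complex.ofReal_mul, Complex.norm_exp_ofReal_mul_I]
  have heq : ν g = ν (fun x => -g x) := by
    refine Measure.ext_of_charFun (funext fun t => ?_)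
    rw [hchar g hg, hchar (fun x => -g x) hg.neg, ← sub_eq_zero, ← integral_sub (hint g hg t)
      (hint (fun x => -g x) hg.neg t), ← h t]
    refine integral_congr_ae (Filter.Eventually.of_forall fun x => ?_)
    simp only
    rw [← sub_mul, ← Complex.ofReal_sub, max_zero_sub_max_neg_zero_eq_self]
  have hae := (withDensity_eq_iff (hm.ennreal_ofReal) (hm.neg.ennreal_ofReal)
    (by simpa using hg.lintegral_lt_top.ne)).1 heq
  filter_upwards [hae] with x hx
  rcases le_total (g x) 0 with h0 | h0
  · rw [ENNReal.ofReal_of_nonpos h0] at hx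
    have := ENNReal.ofReal_eq_zero.1 hx.symm
    simp only [Pi.zero_apply, Pi.neg_apply] at this ⊢; linarith
  · have h3 : ENNReal.ofReal ((-g) x) = 0 := ENNReal.ofReal_of_nonpos (by simpa using h0)
    have := ENNReal.ofReal_eq_zero.1 (hx.trans h3)
    simp only [Pi.zero_apply]; linarith

/-- An integrable function is determined by the Fourier transform of its density. -/
lemma eq_zero_of_forall_integral_mul_exp {μ : Measure ℝ} {f : ℝ → ℂ} (hf : Integrable f μ)
    (h : ∀ t : ℝ, ∫ x, f x * Complex.exp (t * x * Complex.I) ∂μ = 0) : f =ᵐ[μ] 0 := by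
  -- Conjugating the hypothesis at `-t` gives the same for the conjugate of `f`, which separates
  -- real and imaginary parts.
  have hconj (t : ℝ) :
      ∫ x, (starRingEnd ℂ) (f x) * Complex.exp (t * x * Complex.I) ∂μ = 0 := by
    have h1 := congrArg (starRingEnd ℂ) (h (-t))
    rw [← integral_conj, map_zero] at h1
    rw [← h1]
    refine integral_congr_ae (Filter.Eventually.of_forall fun x => ?_)
    simp [← Complex.exp_conj]
  have hb (u : ℝ → ℂ) (hu : Integrable u μ) (t : ℝ) :
      Integrable (fun x => u x * Complex.exp (t * x * Complex.I)) μ := by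
    refine hu.mul_bdd (c := 1)
      (Continuous.aestronglyMeasurable (by fun_prop)) (Filter.Eventually.of_forall fun x => ?_)
    rw [← Complex.ofReal_mul, Complex.norm_exp_ofReal_mul_I]
  have hfc : Integrable (fun x => (starRingEnd ℂ) (f x)) μ :=
    (LinearIsometryEquiv.integrable_comp_iff Complex.conjLIE).2 hf
  have hre := eq_zero_of_forall_integral_mul_exp_real hf.re (fun t => by
    have h2 := integral_add (hb f hf t) (hb _ hfc t)
    rw [h t, hconj t, add_zero] at h2
    have h3 : ∫ x, 2 * (((f x).re : ℂ) * Complex.exp (t * x * Complex.I)) ∂μ = 0 := by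
      rw [← h2]
      refine integral_congr_ae (Filter.Eventually.of_forall fun x => ?_)
      simp only
      rw [← add_mul, Complex.add_conj]; push_cast; ring
    rw [integral_const_mul] at h3
    simpa using h3)
  have him := eq_zero_of_forall_integral_mul_exp_real hf.im (fun t => by
    have h2 := integral_sub (hb f hf t) (hb _ hfc t)
    rw [h t, hconj t, sub_zero] at h2
    have h3 : ∫ x, (2 * Complex.I) * (((f x).im : ℂ) * Complex.exp (t * x * Complex.I)) ∂μ
        = 0 := by
      rw [← h2]
      refine integral_congr_ae (Filter.Eventually.of_forall fun x => ?_)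
      simp only
      rw [← sub_mul, Complex.sub_conj]; push_cast; ring
    rw [integral_const_mul] at h3
    simpa using h3)
  filter_upwards [hre, him] with x h1 h2
  exact Complex.ext h1 h2

end Totality

/-! ### Exponentials, multiplication and composition operators. -/

section Exponentials

/-- The exponential function `x ↦ e^{2πi t x}` of real frequency `t`. -/
def expFunR (t x : ℝ) : ℂ := Complex.exp (2 * Real.pi * Complex.I * t * x)

lemma expFunR_intCast (n : ℤ) : expFunR n = expFun n := by
  funext x; simp [expFunR, expFun]

lemma expFunR_add (s t x : ℝ) : expFunR (s + t) x = expFunR s x * expFunR t x := by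
  rw [expFunR, expFunR, expFunR, ← Complex.exp_add]; push_cast; ring_nf

@[simp] lemma expFunR_zero (x : ℝ) : expFunR 0 x = 1 := by simp [expFunR]

lemma expFunR_eq (t x : ℝ) :
    expFunR t x = Complex.exp (Complex.I * ((2 * Real.pi * t * x : ℝ) : ℂ)) := by
  rw [expFunR]; push_cast; ring_nf

@[simp] lemma norm_expFunR (t x : ℝ) : ‖expFunR t x‖ = 1 := by
  rw [expFunR_eq, mul_comm, Complex.norm_exp_ofReal_mul_I]

lemma conj_expFunR (t x : ℝ) : (starRingEnd ℂ) (expFunR t x) = expFunR (-t) x := by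
  rw [expFunR, expFunR, ← Complex.exp_conj]
  simp [Complex.conj_ofNat]

lemma continuous_expFunR (t : ℝ) : Continuous (expFunR t) := by
  unfold expFunR; fun_prop

lemma norm_expFunR_sub_le (s t x : ℝ) :
    ‖expFunR s x - expFunR t x‖ ≤ 2 * Real.pi * |x| * |s - t| := by
  have h : expFunR s x - expFunR t x = expFunR t x * (expFunR (s - t) x - 1) := by
    rw [mul_sub, ← expFunR_add]; simp
  rw [h, norm_mul, norm_expFunR, one_mul, expFunR_eq]
  refine Real.norm_exp_I_mul_ofReal_sub_one_le.trans (le_of_eq ?_)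
  rw [Real.norm_eq_abs, abs_mul, abs_mul, abs_mul, abs_of_pos Real.pi_pos, abs_two]; ring

lemma memLp_expFunR (t : ℝ) : MemLp (expFunR t) 2 cantorMeasure :=
  MemLp.of_bound (continuous_expFunR t).aestronglyMeasurable 1
    (Filter.Eventually.of_forall fun x => (norm_expFunR t x).le)

/-- The exponential `e_t(x) = e^{2πi t x}` as a vector of `L²(μ_{1/4})`. -/
def eR (t : ℝ) : L2Cantor := (memLp_expFunR t).toLp (expFunR t)

lemma coeFn_eR (t : ℝ) : eR t =ᵐ[cantorMeasure] expFunR t := MemLp.coeFn_toLp _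

lemma eR_intCast (n : ℤ) : eR n = e n := by
  refine (MemLp.toLp_eq_toLp_iff _ _).2 (Filter.Eventually.of_forall fun x => ?_)
  rw [expFunR_intCast]

lemma memLp_expFunR_mul (t : ℝ) (f : L2Cantor) :
    MemLp (fun x => expFunR t x * f x) 2 cantorMeasure :=
  (Lp.memLp f).congr_norm
    ((continuous_expFunR t).aestronglyMeasurable.mul (Lp.aestronglyMeasurable f))
    (Filter.Eventually.of_forall fun x => by simp)

/-- Multiplication by `e_t` as a linear isometry. -/
def mulExpAux (t : ℝ) : L2Cantor →ₗᵢ[ℂ] L2Cantor where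
  toFun f := (memLp_expFunR_mul t f).toLp _
  map_add' f g := by
    rw [← MemLp.toLp_add (memLp_expFunR_mul t f) (memLp_expFunR_mul t g)]
    refine (MemLp.toLp_eq_toLp_iff _ _).2 ?_
    filter_upwards [Lp.coeFn_add f g] with x hx
    rw [hx]; simp [mul_add]
  map_smul' c f := by
    rw [RingHom.id_apply, ← MemLp.toLp_const_smul]
    refine (MemLp.toLp_eq_toLp_iff _ _).2 ?_
    filter_upwards [Lp.coeFn_smul c f] with x hx
    simp [hx, mul_left_comm]
  norm_map' f := by
    simp only [LinearMap.coe_mk, AddHom.coe_mk]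
    rw [Lp.norm_toLp, Lp.norm_def]
    congr 1
    exact eLpNorm_congr_norm_ae (Filter.Eventually.of_forall fun x => by simp)

lemma coeFn_mulExpAux (t : ℝ) (f : L2Cantor) :
    mulExpAux t f =ᵐ[cantorMeasure] fun x => expFunR t x * f x :=
  MemLp.coeFn_toLp (memLp_expFunR_mul t f)

lemma mulExpAux_mulExpAux (s t : ℝ) (f : L2Cantor) :
    mulExpAux s (mulExpAux t f) = mulExpAux (s + t) f := by
  refine Lp.ext ?_
  filter_upwards [coeFn_mulExpAux s (mulExpAux t f), coeFn_mulExpAux t f,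
    coeFn_mulExpAux (s + t) f] with x h1 h2 h3
  rw [h1, h2, h3, expFunR_add, mul_assoc]

lemma mulExpAux_zero (f : L2Cantor) : mulExpAux 0 f = f := by
  refine Lp.ext ?_
  filter_upwards [coeFn_mulExpAux 0 f] with x h
  simp [h]

/-- Multiplication by `e_t` as a unitary operator. -/
def mulExp (t : ℝ) : L2Cantor ≃ₗᵢ[ℂ] L2Cantor :=
  LinearIsometryEquiv.ofSurjective (mulExpAux t) fun f =>
    ⟨mulExpAux (-t) f, by rw [mulExpAux_mulExpAux, add_neg_cancel, mulExpAux_zero]⟩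

lemma coeFn_mulExp (t : ℝ) (f : L2Cantor) :
    mulExp t f =ᵐ[cantorMeasure] fun x => expFunR t x * f x := coeFn_mulExpAux t f

lemma mulExp_eR (s t : ℝ) : mulExp s (eR t) = eR (s + t) := by
  refine Lp.ext ?_
  filter_upwards [coeFn_mulExp s (eR t), coeFn_eR t, coeFn_eR (s + t)] with x h1 h2 h3
  rw [h1, h2, h3, expFunR_add]

lemma mulExp_e (m n : ℤ) : mulExp m (e n) = e (m + n) := by
  rw [← eR_intCast, mulExp_eR, ← eR_intCast]; push_cast; rfl

/-- Composition with the expansive map, as an isometry of `L²(μ_{1/4})`. -/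
def compDilate : L2Cantor →ₗᵢ[ℂ] L2Cantor :=
  Lp.compMeasurePreservingₗᵢ ℂ dilate measurePreserving_dilate

lemma coeFn_compDilate (f : L2Cantor) :
    compDilate f =ᵐ[cantorMeasure] fun x => f (dilate x) :=
  Lp.coeFn_compMeasurePreserving f measurePreserving_dilate

lemma coeFn_compDilate_eR (t : ℝ) :
    compDilate (eR t) =ᵐ[cantorMeasure] fun x => expFunR t (dilate x) := by
  have h := measurePreserving_dilate.quasiMeasurePreserving.ae (coeFn_eR t)
  filter_upwards [coeFn_compDilate (eR t), h] with x h1 h2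
  rw [h1, h2]

/-- Since `dilate x = 4 * x - 2 * ⌊2 * x⌋`, only a phase depending on the first digit is lost; it is
trivial for integer `t`. -/
lemma expFunR_dilate (t x : ℝ) :
    expFunR t (dilate x) = expFunR (4 * t) x *
      Complex.exp (-(4 * Real.pi * Complex.I * t * ⌊2 * x⌋)) := by
  rw [dilate, Int.fract, expFunR, expFunR, ← Complex.exp_add]
  push_cast
  ring_nf

lemma compDilate_e (n : ℤ) : compDilate (e n) = e (4 * n) := by
  rw [← eR_intCast, ← eR_intCast]
  refine Lp.ext ?_
  filter_upwards [coeFn_compDilate_eR n, coeFn_eR ((4 * n : ℤ) : ℝ)] with x h1 h2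
  have h3 : Complex.exp (-(4 * Real.pi * Complex.I * (n : ℝ) * ⌊2 * x⌋)) = 1 :=
    Complex.exp_eq_one_iff.2 ⟨-(2 * n * ⌊2 * x⌋), by push_cast; ring⟩
  rw [h1, h2, expFunR_dilate, h3, mul_one]
  push_cast; rfl

lemma expFunR_swap {p : ℤ} (hp : Odd p) (x : ℝ) : expFunR p (swap x) = -expFunR p x := by
  obtain ⟨k, rfl⟩ := hp
  have h1 : Complex.exp (Real.pi * Complex.I * (2 * k + 1)) = -1 := by
    rw [← Complex.exp_pi_mul_I, Complex.exp_eq_exp_iff_exists_int]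
    exact ⟨k, by ring⟩
  have h2 : Complex.exp (-(Real.pi * Complex.I * (2 * k + 1))) = -1 := by
    rw [Complex.exp_neg, h1]; norm_num
  unfold swap
  split_ifs
  · rw [← mul_neg_one, ← h1, expFunR, expFunR, ← Complex.exp_add]; push_cast; ring_nf
  · rw [← mul_neg_one, ← h2, expFunR, expFunR, ← Complex.exp_add]; push_cast; ring_nf

/-- The ranges of `compDilate` and of its twist by an odd exponential are orthogonal. -/
lemma inner_compDilate_mulExp {p : ℤ} (hp : Odd p) (f g : L2Cantor) :
    inner ℂ (compDilate f) (mulExp p (compDilate g)) = 0 := by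
  let h : ℝ → ℂ := fun y => inner ℂ (f y) (g y)
  -- `F` is odd under the measure-preserving `swap`, so its integral is its own negative.
  let F : ℝ → ℂ := fun x => expFunR p x * h (dilate x)
  have hh : AEStronglyMeasurable h cantorMeasure :=
    (Lp.aestronglyMeasurable f).inner (Lp.aestronglyMeasurable g)
  have hF : AEStronglyMeasurable F cantorMeasure :=
    (continuous_expFunR p).aestronglyMeasurable.mul
      (hh.comp_measurePreserving measurePreserving_dilate)
  have h1 : inner ℂ (compDilate f) (mulExp p (compDilate g)) = ∫ x, F x ∂cantorMeasure := by
    rw [L2.inner_def]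
    refine integral_congr_ae ?_
    filter_upwards [coeFn_compDilate f, coeFn_compDilate g,
      coeFn_mulExp p (compDilate g)] with x h1 h2 h3
    simp only [F, h, h1, h3, h2, RCLike.inner_apply]
    ring
  have h2 : ∫ x, F x ∂cantorMeasure = ∫ x, F (swap x) ∂cantorMeasure := by
    conv_lhs => rw [← measurePreserving_swap.map_eq]
    exact integral_map measurable_swap.aemeasurable (by rwa [measurePreserving_swap.map_eq])
  have h3 : ∫ x, F (swap x) ∂cantorMeasure = -∫ x, F x ∂cantorMeasure := by
    rw [← integral_neg]
    refine integral_congr_ae (Filter.Eventually.of_forall fun x => ?_)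
    simp only [F]
    rw [expFunR_swap hp, dilate_swap, neg_mul]
  rw [h1]
  exact CharZero.eq_neg_self_iff.1 (h2.trans h3)

/-- The two-scale relation for the exponentials. -/
lemma eR_eq_add {p : ℤ} (hp : Odd p) (t : ℝ) :
    eR t = ((1 + Complex.exp (Real.pi * t * Complex.I)) / 2) • compDilate (eR (t / 4))
      + ((1 - Complex.exp (Real.pi * t * Complex.I)) / 2) •
        mulExp p (compDilate (eR ((t - p) / 4))) := by
  refine Lp.ext ?_
  filter_upwards [ae_mem_Ico, coeFn_eR t, coeFn_compDilate_eR (t / 4),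
    coeFn_compDilate_eR ((t - p) / 4), coeFn_mulExp p (compDilate (eR ((t - p) / 4))),
    Lp.coeFn_add (((1 + Complex.exp (Real.pi * t * Complex.I)) / 2) • compDilate (eR (t / 4)))
      (((1 - Complex.exp (Real.pi * t * Complex.I)) / 2) •
        mulExp p (compDilate (eR ((t - p) / 4)))),
    Lp.coeFn_smul ((1 + Complex.exp (Real.pi * t * Complex.I)) / 2) (compDilate (eR (t / 4))),
    Lp.coeFn_smul ((1 - Complex.exp (Real.pi * t * Complex.I)) / 2)
      (mulExp p (compDilate (eR ((t - p) / 4))))] with x hx h1 h2 h3 h4 h5 h6 h7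
  rw [h1, h5, Pi.add_apply, h6, h7, Pi.smul_apply, Pi.smul_apply, h2, h4, h3, expFunR_dilate,
    expFunR_dilate, ← mul_assoc (expFunR (p : ℝ) x), ← expFunR_add,
    mul_div_cancel₀ _ (four_ne_zero), mul_div_cancel₀ _ (four_ne_zero), add_sub_cancel,
    smul_eq_mul, smul_eq_mul]
  -- With `z = exp (π t i)`, the two terms carry phases `1, 1` for digit `0` and `z⁻¹, -z⁻¹` for
  -- digit `1`; the weights `(1 ± z) / 2` make the sum `1` in both cases.
  have hd : ⌊2 * x⌋ = 0 ∨ ⌊2 * x⌋ = 1 := by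
    have h0 : 0 ≤ ⌊2 * x⌋ := Int.floor_nonneg.2 (by linarith [hx.1])
    have h2 : ⌊2 * x⌋ < 2 := Int.floor_lt.2 (by push_cast; linarith [hx.2])
    omega
  rcases hd with hd | hd
  · rw [hd]; simp; ring
  · obtain ⟨k, rfl⟩ := hp
    have e1 : Complex.exp (-(4 * Real.pi * Complex.I * ((t / 4 : ℝ) : ℂ) * ((1 : ℤ) : ℂ)))
        = (Complex.exp (Real.pi * t * Complex.I))⁻¹ := by
      rw [← Complex.exp_neg]; push_cast; ring_nf
    have e2 : Complex.exp (-(4 * Real.pi * Complex.I *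
        (((t - ((2 * k + 1 : ℤ) : ℝ)) / 4 : ℝ) : ℂ) * ((1 : ℤ) : ℂ)))
        = -(Complex.exp (Real.pi * t * Complex.I))⁻¹ := by
      rw [← mul_neg_one (Complex.exp _)⁻¹, ← Complex.exp_pi_mul_I, ← Complex.exp_neg,
        ← Complex.exp_add, Complex.exp_eq_exp_iff_exists_int]
      exact ⟨k, by push_cast; ring⟩
    rw [hd, e1, e2]
    have hne := Complex.exp_ne_zero (Real.pi * t * Complex.I)
    field_simp
    ring

lemma norm_eR (t : ℝ) : ‖eR t‖ = 1 := by
  rw [eR, Lp.norm_toLp, eLpNorm_congr_norm_ae (g := fun _ => (1 : ℂ))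
    (Filter.Eventually.of_forall fun x => by simp), eLpNorm_const _ (by simp)
    (IsProbabilityMeasure.ne_zero _)]
  simp

/-- The measure lives on `[0, 1)`, so the map is `2π`-Lipschitz. -/
lemma continuous_eR : Continuous eR := by
  refine (LipschitzWith.of_dist_le_mul (K := ⟨2 * Real.pi, by positivity⟩)
    fun s t => ?_).continuous
  rw [dist_eq_norm, Real.dist_eq]
  refine (Lp.norm_le_of_ae_bound (C := 2 * Real.pi * |s - t|) (by positivity) ?_).trans ?_
  · filter_upwards [ae_mem_Ico, coeFn_eR s, coeFn_eR t, Lp.coeFn_sub (eR s) (eR t)]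
      with x hx h1 h2 h3
    rw [h3, Pi.sub_apply, h1, h2]
    refine (norm_expFunR_sub_le s t x).trans ?_
    refine mul_le_mul_of_nonneg_right ?_ (abs_nonneg _)
    refine mul_le_of_le_one_right (by positivity) ?_
    rw [abs_of_nonneg hx.1]; exact hx.2.le
  · simp [measureUnivNNReal]
    rfl

lemma eq_zero_of_forall_inner_eR {f : L2Cantor} (h : ∀ t, inner ℂ (eR t) f = 0) : f = 0 := by
  refine (Lp.eq_zero_iff_ae_eq_zero).2 (eq_zero_of_forall_integral_mul_exp
    ((Lp.memLp f).integrable (by norm_num)) fun t => ?_)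
  -- The sign compensates for the conjugation in the first slot of the inner product.
  rw [← h (-(t / (2 * Real.pi))), L2.inner_def]
  refine integral_congr_ae ?_
  filter_upwards [coeFn_eR (-(t / (2 * Real.pi)))] with x hx
  rw [hx, RCLike.inner_apply, conj_expFunR, neg_neg, expFunR]
  congr 2
  have : (Real.pi : ℂ) ≠ 0 := by exact_mod_cast Real.pi_ne_zero
  push_cast
  field_simp

end Exponentials

/-! ### Rigidity of the two-scale equation. -/

section TwoScale

/-- A continuous function `Q ≤ 1` with `Q 0 = 1` that solves the two-scale equation
`Q t = α t * Q (t / 4) + β t * Q ((t - p) / 4)` for convex weights is constant when the zeros of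
`α` are odd integers and the branch `t ↦ (t - p) / 4` has no cycle among them. -/
lemma eq_one_of_two_scale {Q α β : ℝ → ℝ} {p : ℝ} (hp : p = 1 ∨ p = 5) (hQ : Continuous Q)
    (h0 : Q 0 = 1) (hle : ∀ t, Q t ≤ 1) (hα : ∀ t, 0 ≤ α t) (hβ : ∀ t, 0 ≤ β t)
    (hαβ : ∀ t, α t + β t = 1) (hz : ∀ t, |t| ≤ 2 → α t = 0 → |t| = 1)
    (h : ∀ t, Q t = α t * Q (t / 4) + β t * Q ((t - p) / 4)) (t : ℝ) : Q t = 1 := by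
  have hp1 : 1 ≤ p := by rcases hp with rfl | rfl <;> norm_num
  have hp5 : p ≤ 5 := by rcases hp with rfl | rfl <;> norm_num
  -- As `1 ≤ p ≤ 5`, both branches map `[-2, 2]` into itself, so minimality on this interval can be
  -- propagated along them.
  obtain ⟨t₀, ht₀, hmin⟩ := (isCompact_Icc (a := (-2 : ℝ)) (b := 2)).exists_isMinOn
    ⟨0, by norm_num, by norm_num⟩ hQ.continuousOn
  have hm : ∀ s, |s| ≤ 2 → Q t₀ ≤ Q s := fun s hs => hmin (abs_le.1 hs)
  -- A convex combination equal to the minimum attains it in each term of positive weight.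
  have step0 : ∀ s, |s| ≤ 2 → α s ≠ 0 → Q s = Q t₀ → Q (s / 4) = Q t₀ := by
    intro s hs hαs hQs
    have hs' := abs_le.1 hs
    have h1 := hm (s / 4) (abs_le.2 ⟨by linarith, by linarith⟩)
    have h2 := hm ((s - p) / 4) (abs_le.2 ⟨by linarith, by linarith⟩)
    have hpos : 0 < α s := lt_of_le_of_ne (hα s) (Ne.symm hαs)
    have h3 : α s * (Q (s / 4) - Q t₀) + β s * (Q ((s - p) / 4) - Q t₀) = 0 := by
      have := h s
      have h4 : Q t₀ = (α s + β s) * Q t₀ := by rw [hαβ, one_mul]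
      linarith
    have h5 := mul_nonneg (hβ s) (sub_nonneg.2 h2)
    have h6 := mul_nonneg (hα s) (sub_nonneg.2 h1)
    have h7 : α s * (Q (s / 4) - Q t₀) = 0 := by linarith
    have := (mul_eq_zero.1 h7).resolve_left hαs
    linarith
  have step1 : ∀ s, α s = 0 → Q s = Q t₀ → Q ((s - p) / 4) = Q t₀ := by
    intro s hαs hQs
    have h1 := hαβ s
    have h2 := h s
    rw [hαs, zero_add] at h1
    rw [hαs, h1, zero_mul, zero_add, one_mul] at h2
    rw [← h2, hQs]
  -- Below modulus `1` the weight `α` never vanishes, so the minimum is carried along `s / 4 ^ k` to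
  -- `0`.
  have small : ∀ s, |s| < 1 → Q s = Q t₀ → Q t₀ = 1 := by
    intro s hs hQs
    have hk : ∀ k : ℕ, Q (s * (1 / 4) ^ k) = Q t₀ := by
      intro k
      induction k with
      | zero => simpa using hQs
      | succ k ih =>
        have hlt : |s * (1 / 4) ^ k| < 1 := by
          rw [abs_mul, abs_of_nonneg (by positivity : (0 : ℝ) ≤ (1 / 4) ^ k)]
          exact (mul_le_of_le_one_right (abs_nonneg s)
            (pow_le_one₀ (by norm_num) (by norm_num))).trans_lt hs
        have := step0 _ (by linarith) (fun hc => hlt.ne (hz _ (by linarith) hc)) ih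
        rwa [pow_succ, ← mul_assoc, mul_one_div]
    have hlim : Filter.Tendsto (fun k : ℕ => s * (1 / 4 : ℝ) ^ k) Filter.atTop (nhds 0) := by
      simpa using (tendsto_pow_atTop_nhds_zero_of_lt_one (r := (1 / 4 : ℝ)) (by norm_num)
        (by norm_num)).const_mul s
    have h2 := (hQ.tendsto 0).comp hlim
    have h3 : Q ∘ (fun k : ℕ => s * (1 / 4 : ℝ) ^ k) = fun _ => Q t₀ := funext hk
    rw [h3, h0] at h2
    exact tendsto_nhds_unique tendsto_const_nhds h2
  have quarter : ∀ s, |s| ≤ 2 → α s ≠ 0 → Q s = Q t₀ → Q t₀ = 1 := by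
    intro s hs hαs hQs
    have hs' := abs_le.1 hs
    exact small (s / 4) (abs_lt.2 ⟨by linarith, by linarith⟩) (step0 s hs hαs hQs)
  have generic : ∀ s, |s| ≤ 2 → |s| ≠ 1 → Q s = Q t₀ → Q t₀ = 1 :=
    fun s hs hs1 => quarter s hs fun hc => hs1 (hz s hs hc)
  -- Where `α` vanishes the other branch takes over: `1 ↦ 0`, `-1 ↦ -1/2` for `p = 1`, and `1 ↦ -1 ↦
  -- -3/2` for `p = 5`. For `p = 3` the point `-1` would be fixed and the argument would fail.
  have neg_one : Q (-1) = Q t₀ → Q t₀ = 1 := by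
    intro hQs
    by_cases hα1 : α (-1) = 0
    · have h1 := step1 _ hα1 hQs
      rcases hp with rfl | rfl
      · exact generic _ (by norm_num [abs_le]) (by norm_num [abs]) h1
      · exact generic _ (by norm_num [abs_le]) (by norm_num [abs]) h1
    · exact quarter _ (by norm_num) hα1 hQs
  have one : Q 1 = Q t₀ → Q t₀ = 1 := by
    intro hQs
    by_cases hα1 : α 1 = 0
    · have h1 := step1 _ hα1 hQs
      rcases hp with rfl | rfl
      · exact generic _ (by norm_num [abs_le]) (by norm_num [abs]) h1
      · exact neg_one (by norm_num at h1; exact h1)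
    · exact quarter _ (by norm_num) hα1 hQs
  have hmin1 : Q t₀ = 1 := by
    by_cases ht1 : |t₀| = 1
    · rcases eq_or_eq_neg_of_abs_eq ht1 with ht1 | ht1
      · exact one (by rw [ht1])
      · exact neg_one (by rw [ht1])
    · exact generic t₀ (abs_le.2 ht₀) ht1 rfl
  -- Both branches contract: `|s| ≤ 3 + n` gives `(|s| + 5) / 4 ≤ 2 + n`.
  have hall : ∀ n : ℕ, ∀ s : ℝ, |s| ≤ 2 + n → Q s = 1 := by
    intro n
    induction n with
    | zero =>
      intro s hs
      have := hm s (by simpa using hs)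
      exact le_antisymm (hle s) (by linarith)
    | succ n ih =>
      intro s hs
      have hs' := abs_le.1 hs
      have hn : (0 : ℝ) ≤ n := n.cast_nonneg
      push_cast at hs'
      rw [h s, ih (s / 4) (abs_le.2 ⟨by linarith, by linarith⟩),
        ih ((s - p) / 4) (abs_le.2 ⟨by linarith, by linarith⟩), mul_one, mul_one, hαβ]
  obtain ⟨n, hn⟩ := exists_nat_ge |t|
  exact hall n t (by linarith)

end TwoScale

/-! ### The exponential bases over `Γ` and `5Γ`. -/

section Spectrum

lemma mem_Γ_iff {γ : ℤ} : γ ∈ Γ ↔ ∃ γ' ∈ Γ, γ = 4 * γ' ∨ γ = 4 * γ' + 1 := by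
  constructor
  · rintro ⟨m, a, ha, rfl⟩
    have hmem : ∑ i ∈ Finset.range m, a (i + 1) * 4 ^ i ∈ Γ := by
      cases m with
      | zero => exact ⟨0, 0, fun _ => Or.inl rfl, by simp⟩
      | succ k => exact ⟨k, fun i => a (i + 1), fun i => ha _, rfl⟩
    refine ⟨_, hmem, ?_⟩
    rw [Finset.sum_range_succ', Finset.mul_sum]
    have hs : ∑ i ∈ Finset.range m, a (i + 1) * 4 ^ (i + 1)
        = ∑ i ∈ Finset.range m, 4 * (a (i + 1) * 4 ^ i) :=
      Finset.sum_congr rfl fun i _ => by ring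
    rw [hs]
    rcases ha 0 with h | h <;> simp [h]
  · have key (m : ℕ) (a : ℕ → ℤ) (ha : ∀ i, a i = 0 ∨ a i = 1) (b : ℤ) (hb : b = 0 ∨ b = 1) :
        4 * (∑ i ∈ Finset.range (m + 1), a i * 4 ^ i) + b ∈ Γ := by
      refine ⟨m + 1, fun i => Nat.casesOn i b a, fun i => ?_, ?_⟩
      · cases i with
        | zero => exact hb
        | succ i => exact ha i
      · rw [Finset.sum_range_succ' _ (m + 1), Finset.mul_sum]
        simp only [pow_zero, mul_one]
        congr 1
        exact Finset.sum_congr rfl fun i _ => by ring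
    rintro ⟨_, ⟨m, a, ha, rfl⟩, rfl | rfl⟩
    · simpa using key m a ha 0 (Or.inl rfl)
    · exact key m a ha 1 (Or.inr rfl)

lemma zero_mem_Γ : (0 : ℤ) ∈ Γ := ⟨0, 0, fun _ => Or.inl rfl, by simp⟩

lemma four_mul_mem_Γ {γ : ℤ} (h : γ ∈ Γ) : 4 * γ ∈ Γ := mem_Γ_iff.2 ⟨γ, h, Or.inl rfl⟩

lemma four_mul_add_one_mem_Γ {γ : ℤ} (h : γ ∈ Γ) : 4 * γ + 1 ∈ Γ :=
  mem_Γ_iff.2 ⟨γ, h, Or.inr rfl⟩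

lemma nonneg_of_mem_Γ {γ : ℤ} (h : γ ∈ Γ) : 0 ≤ γ := by
  obtain ⟨m, a, ha, rfl⟩ := h
  refine Finset.sum_nonneg fun i _ => mul_nonneg ?_ (by positivity)
  rcases ha i with h | h <;> simp [h]

/-- Distinct elements of `Γ` differ by a power of `4` times an odd integer. -/
lemma exists_sub_eq_of_mem_Γ {γ γ' : ℤ} (h : γ ∈ Γ) (h' : γ' ∈ Γ) (hne : γ ≠ γ') :
    ∃ (j : ℕ) (k : ℤ), Odd k ∧ γ' - γ = 4 ^ j * k := by
  -- Strip equal lowest base-4 digits, one factor `4` each; at the first differing digit the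
  -- difference is `±1` modulo `4`.
  have main : ∀ N : ℕ, ∀ γ ∈ Γ, ∀ γ' ∈ Γ, γ ≤ N → γ' ≤ N → γ ≠ γ' →
      ∃ (j : ℕ) (k : ℤ), Odd k ∧ γ' - γ = 4 ^ j * k := by
    intro N
    induction N with
    | zero =>
      intro γ h γ' h' hN hN' hne
      have := nonneg_of_mem_Γ h
      have := nonneg_of_mem_Γ h'
      push_cast at hN hN'
      omega
    | succ N ih =>
      intro γ h γ' h' hN hN' hne
      obtain ⟨δ, hδ, h1⟩ := mem_Γ_iff.1 h
      obtain ⟨δ', hδ', h1'⟩ := mem_Γ_iff.1 h'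
      have hn := nonneg_of_mem_Γ hδ
      have hn' := nonneg_of_mem_Γ hδ'
      push_cast at hN hN'
      rcases h1 with rfl | rfl <;> rcases h1' with rfl | rfl
      · obtain ⟨j, k, hk, hjk⟩ := ih δ hδ δ' hδ' (by omega) (by omega) (by omega)
        exact ⟨j + 1, k, hk, by rw [pow_succ]; linarith⟩
      · exact ⟨0, 4 * (δ' - δ) + 1, ⟨2 * (δ' - δ), by ring⟩, by ring⟩
      · exact ⟨0, 4 * (δ' - δ) - 1, ⟨2 * (δ' - δ) - 1, by ring⟩, by ring⟩
      · obtain ⟨j, k, hk, hjk⟩ := ih δ hδ δ' hδ' (by omega) (by omega) (by omega)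
        exact ⟨j + 1, k, hk, by rw [pow_succ]; linarith⟩
  refine main (γ.toNat + γ'.toNat) γ h γ' h' ?_ ?_ hne <;> push_cast <;> omega

lemma inner_e (m n : ℤ) : inner ℂ (e m) (e n) = inner ℂ (e 0) (e (n - m)) := by
  have h1 : e m = mulExp m (e 0) := by rw [mulExp_e, add_zero]
  have h2 : e n = mulExp m (e (n - m)) := by rw [mulExp_e, add_sub_cancel]
  rw [h1, h2, LinearIsometryEquiv.inner_map_map]

/-- `compDilate` fixes `e 0` and multiplies frequencies by `4`, which removes the power; for odd `k`
the vectors lie in orthogonal ranges. -/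
lemma inner_e_zero (j : ℕ) {k : ℤ} (hk : Odd k) : inner ℂ (e 0) (e (4 ^ j * k)) = 0 := by
  induction j with
  | zero =>
    have h := inner_compDilate_mulExp hk (e 0) (e 0)
    rwa [compDilate_e, mulExp_e, mul_zero, add_zero, ← one_mul k, ← pow_zero (4 : ℤ)] at h
  | succ j ih =>
    have h : e 0 = compDilate (e 0) := by rw [compDilate_e, mul_zero]
    rw [pow_succ', mul_assoc, ← compDilate_e, h, LinearIsometry.inner_map_map, ih]

lemma norm_e (n : ℤ) : ‖e n‖ = 1 := by rw [← eR_intCast, norm_eR]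

lemma orthonormal_e {p : ℤ} (hp : Odd p) : Orthonormal ℂ fun γ : Γ => e (p * γ) := by
  refine ⟨fun γ => norm_e _, fun γ γ' hne => ?_⟩
  obtain ⟨j, k, hk, hjk⟩ := exists_sub_eq_of_mem_Γ γ.2 γ'.2 (Subtype.coe_injective.ne hne)
  simp only
  rw [inner_e, ← mul_sub, hjk, mul_left_comm]
  exact inner_e_zero j (hp.mul hk)

/-- The closed linear span of the exponentials with frequencies in `p Γ`. -/
def spectralSpan (p : ℤ) : Submodule ℂ L2Cantor :=
  (Submodule.span ℂ (Set.range fun γ : Γ => e (p * γ))).topologicalClosure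

instance (p : ℤ) : CompleteSpace (spectralSpan p) :=
  inferInstanceAs (CompleteSpace (Submodule.topologicalClosure _))

lemma e_mem_spectralSpan (p : ℤ) {γ : ℤ} (h : γ ∈ Γ) : e (p * γ) ∈ spectralSpan p :=
  Submodule.le_topologicalClosure _ (Submodule.subset_span ⟨⟨γ, h⟩, rfl⟩)

lemma mem_spectralSpan_orthogonal_iff {p : ℤ} {f : L2Cantor} :
    f ∈ (spectralSpan p)ᗮ ↔ ∀ γ ∈ Γ, inner ℂ (e (p * γ)) f = 0 := by
  refine ⟨fun h γ hγ => (Submodule.mem_orthogonal _ _).1 h _ (e_mem_spectralSpan p hγ),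
    fun h => ?_⟩
  rw [spectralSpan, Submodule.orthogonal_closure, Submodule.mem_orthogonal]
  intro u hu
  induction hu using Submodule.span_induction with
  | mem x hx => obtain ⟨γ, rfl⟩ := hx; exact h γ γ.2
  | zero => exact inner_zero_left _
  | add x y _ _ hx hy => rw [inner_add_left, hx, hy, add_zero]
  | smul c x _ hx => rw [inner_smul_left, hx, mul_zero]

lemma map_mem_spectralSpan {p : ℤ} (T : L2Cantor →L[ℂ] L2Cantor)
    (hT : ∀ γ ∈ Γ, T (e (p * γ)) ∈ spectralSpan p) {f : L2Cantor} (hf : f ∈ spectralSpan p) :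
    T f ∈ spectralSpan p := by
  have h : spectralSpan p ≤ (spectralSpan p).comap (T : L2Cantor →ₗ[ℂ] L2Cantor) := by
    refine Submodule.topologicalClosure_minimal _ (Submodule.span_le.2 ?_)
      ((Submodule.isClosed_topologicalClosure _).preimage T.continuous)
    rintro _ ⟨γ, rfl⟩
    exact hT γ γ.2
  exact h hf

lemma compDilate_mem_spectralSpan {p : ℤ} {f : L2Cantor} (hf : f ∈ spectralSpan p) :
    compDilate f ∈ spectralSpan p := by
  refine map_mem_spectralSpan compDilate.toContinuousLinearMap (fun γ hγ => ?_) hf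
  simp only [LinearIsometry.coe_toContinuousLinearMap]
  rw [compDilate_e, mul_left_comm]
  exact e_mem_spectralSpan p (four_mul_mem_Γ hγ)

lemma mulExp_compDilate_e (p γ : ℤ) :
    mulExp p (compDilate (e (p * γ))) = e (p * (4 * γ + 1)) := by
  rw [compDilate_e, mulExp_e]; congr 1; ring

lemma mulExp_compDilate_mem_spectralSpan {p : ℤ} {f : L2Cantor} (hf : f ∈ spectralSpan p) :
    mulExp p (compDilate f) ∈ spectralSpan p := by
  refine map_mem_spectralSpan
    ((mulExp p).toLinearIsometry.comp compDilate).toContinuousLinearMap (fun γ hγ => ?_) hf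
  have h : mulExp p (compDilate (e (p * γ))) ∈ spectralSpan p := by
    rw [mulExp_compDilate_e]
    exact e_mem_spectralSpan p (four_mul_add_one_mem_Γ hγ)
  exact h

/-- Test against `e (p * γ)`: a last digit `0` is removed by the isometry, and a last digit `1` puts
the exponential in the orthogonal range. -/
lemma compDilate_mem_orthogonal {p : ℤ} (hp : Odd p) {f : L2Cantor}
    (hf : f ∈ (spectralSpan p)ᗮ) : compDilate f ∈ (spectralSpan p)ᗮ := by
  rw [mem_spectralSpan_orthogonal_iff] at hf ⊢
  intro γ hγ
  obtain ⟨δ, hδ, rfl | rfl⟩ := mem_Γ_iff.1 hγ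
  · rw [mul_left_comm, ← compDilate_e, LinearIsometry.inner_map_map, hf δ hδ]
  · rw [← mulExp_compDilate_e, inner_eq_zero_symm, inner_compDilate_mulExp hp]

lemma mulExp_compDilate_mem_orthogonal {p : ℤ} (hp : Odd p) {f : L2Cantor}
    (hf : f ∈ (spectralSpan p)ᗮ) : mulExp p (compDilate f) ∈ (spectralSpan p)ᗮ := by
  rw [mem_spectralSpan_orthogonal_iff] at hf ⊢
  intro γ hγ
  obtain ⟨δ, hδ, rfl | rfl⟩ := mem_Γ_iff.1 hγ
  · rw [mul_left_comm, ← compDilate_e, inner_compDilate_mulExp hp]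
  · rw [← mulExp_compDilate_e, LinearIsometryEquiv.inner_map_map, LinearIsometry.inner_map_map,
      hf δ hδ]

/-- Both isometries preserve the span and its complement, so the projection passes through
`eR_eq_add` term by term. -/
lemma starProjection_eR {p : ℤ} (hp : Odd p) (t : ℝ) :
    (spectralSpan p).starProjection (eR t)
      = ((1 + Complex.exp (Real.pi * t * Complex.I)) / 2) •
          compDilate ((spectralSpan p).starProjection (eR (t / 4)))
        + ((1 - Complex.exp (Real.pi * t * Complex.I)) / 2) •
          mulExp p (compDilate ((spectralSpan p).starProjection (eR ((t - p) / 4)))) := by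
  refine Submodule.eq_starProjection_of_mem_orthogonal (K := spectralSpan p) ?_ ?_
  · exact (spectralSpan p).add_mem
      ((spectralSpan p).smul_mem _
        (compDilate_mem_spectralSpan ((spectralSpan p).starProjection_apply_mem _)))
      ((spectralSpan p).smul_mem _
        (mulExp_compDilate_mem_spectralSpan ((spectralSpan p).starProjection_apply_mem _)))
  · rw [eR_eq_add hp t]
    rw [add_sub_add_comm, ← smul_sub, ← smul_sub, ← map_sub, ← map_sub, ← map_sub]
    exact (spectralSpan p)ᗮ.add_mem
      ((spectralSpan p)ᗮ.smul_mem _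
        (compDilate_mem_orthogonal hp ((spectralSpan p).sub_starProjection_mem_orthogonal _)))
      ((spectralSpan p)ᗮ.smul_mem _
        (mulExp_compDilate_mem_orthogonal hp
          ((spectralSpan p).sub_starProjection_mem_orthogonal _)))

lemma norm_sq_starProjection_eR {p : ℤ} (hp : Odd p) (t : ℝ) :
    ‖(spectralSpan p).starProjection (eR t)‖ ^ 2
      = ‖(1 + Complex.exp (Real.pi * t * Complex.I)) / 2‖ ^ 2 *
          ‖(spectralSpan p).starProjection (eR (t / 4))‖ ^ 2
        + ‖(1 - Complex.exp (Real.pi * t * Complex.I)) / 2‖ ^ 2 *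
          ‖(spectralSpan p).starProjection (eR ((t - p) / 4))‖ ^ 2 := by
  rw [starProjection_eR hp t, pow_two,
    norm_add_sq_eq_norm_sq_add_norm_sq_of_inner_eq_zero (𝕜 := ℂ), norm_smul, norm_smul,
    LinearIsometryEquiv.norm_map, LinearIsometry.norm_map, LinearIsometry.norm_map]
  · ring
  · rw [inner_smul_left, inner_smul_right, inner_compDilate_mulExp hp, mul_zero, mul_zero]

/-- The weights are `cos² (π t / 2)` and `sin² (π t / 2)`. -/
lemma norm_sq_add_norm_sq_weights (t : ℝ) :
    ‖(1 + Complex.exp (Real.pi * t * Complex.I)) / 2‖ ^ 2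
      + ‖(1 - Complex.exp (Real.pi * t * Complex.I)) / 2‖ ^ 2 = 1 := by
  have h := parallelogram_law_with_norm ℂ 1 (Complex.exp (Real.pi * t * Complex.I))
  rw [← Complex.ofReal_mul, Complex.norm_exp_ofReal_mul_I, norm_one] at h
  rw [norm_div, norm_div, Complex.norm_ofNat, ← Complex.ofReal_mul]
  linarith

lemma abs_eq_one_of_weight_eq_zero {t : ℝ} (ht : |t| ≤ 2)
    (h : ‖(1 + Complex.exp (Real.pi * t * Complex.I)) / 2‖ ^ 2 = 0) : |t| = 1 := by
  have h1 : Complex.exp (Real.pi * t * Complex.I) = Complex.exp (Real.pi * Complex.I) := by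
    rw [Complex.exp_pi_mul_I]
    simp only [ne_eq, OfNat.ofNat_ne_zero, not_false_eq_true, pow_eq_zero_iff, norm_eq_zero,
      div_eq_zero_iff, or_false] at h
    exact eq_neg_of_add_eq_zero_right h
  obtain ⟨n, hn⟩ := Complex.exp_eq_exp_iff_exists_int.1 h1
  have hpi : (Real.pi : ℂ) * Complex.I ≠ 0 :=
    mul_ne_zero (by exact_mod_cast Real.pi_ne_zero) Complex.I_ne_zero
  have h2 : (t : ℂ) = 1 + 2 * n := by
    apply mul_left_cancel₀ hpi
    linear_combination hn
  have h3 : t = 1 + 2 * n := by exact_mod_cast h2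
  have ht' := abs_le.1 ht
  have hn1 : -2 < n := by
    have : (-2 : ℝ) < n := by linarith
    exact_mod_cast this
  have hn2 : n < 1 := by
    have : (n : ℝ) < 1 := by linarith
    exact_mod_cast this
  have : n = -1 ∨ n = 0 := by omega
  rcases this with rfl | rfl
  · rw [h3]; norm_num
  · rw [h3]; norm_num

lemma eR_mem_spectralSpan {p : ℤ} (hp : p = 1 ∨ p = 5) (t : ℝ) : eR t ∈ spectralSpan p := by
  have hodd : Odd p := by rcases hp with rfl | rfl <;> decide
  have h := eq_one_of_two_scale (Q := fun t => ‖(spectralSpan p).starProjection (eR t)‖ ^ 2)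
    (p := p) (by rcases hp with rfl | rfl <;> norm_num)
    (((spectralSpan p).starProjection.continuous.comp continuous_eR).norm.pow 2) ?_ ?_
    (fun t => by positivity) (fun t => by positivity) norm_sq_add_norm_sq_weights
    (fun t => abs_eq_one_of_weight_eq_zero) (norm_sq_starProjection_eR hodd) t
  · rw [Submodule.mem_iff_norm_starProjection, norm_eR]
    exact (pow_eq_one_iff_of_nonneg (norm_nonneg _) two_ne_zero).1 h
  · have h0 : eR 0 ∈ spectralSpan p := by
      have := e_mem_spectralSpan p zero_mem_Γ
      rwa [mul_zero, ← eR_intCast, Int.cast_zero] at this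
    rw [(Submodule.mem_iff_norm_starProjection _ _).1 h0, norm_eR, one_pow]
  · intro t
    refine pow_le_one₀ (norm_nonneg _) ?_
    exact ((spectralSpan p).norm_starProjection_apply_le _).trans (norm_eR t).le

lemma orthogonal_span_e_eq_bot {p : ℤ} (hp : p = 1 ∨ p = 5) :
    (Submodule.span ℂ (Set.range fun γ : Γ => e (p * γ)))ᗮ = ⊥ := by
  rw [← Submodule.orthogonal_closure, Submodule.eq_bot_iff]
  exact fun f hf => eq_zero_of_forall_inner_eR fun t =>
    (Submodule.mem_orthogonal _ _).1 hf _ (eR_mem_spectralSpan hp t)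

/-- The exponentials with frequencies in `Γ` form a Hilbert basis of `L²(μ_{1/4})`. -/
def basisΓ : HilbertBasis Γ ℂ L2Cantor :=
  HilbertBasis.mkOfOrthogonalEqBot (orthonormal_e odd_one) (orthogonal_span_e_eq_bot (Or.inl rfl))

/-- The exponentials with frequencies in `5 Γ` form a Hilbert basis of `L²(μ_{1/4})`. -/
def basisFiveΓ : HilbertBasis Γ ℂ L2Cantor :=
  HilbertBasis.mkOfOrthogonalEqBot (orthonormal_e (p := 5) (by decide))
    (orthogonal_span_e_eq_bot (Or.inr rfl))

lemma basisΓ_apply (γ : Γ) : basisΓ γ = e γ := by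
  rw [basisΓ, HilbertBasis.coe_mkOfOrthogonalEqBot, one_mul]

lemma basisFiveΓ_apply (γ : Γ) : basisFiveΓ γ = e (5 * γ) := by
  rw [basisFiveΓ, HilbertBasis.coe_mkOfOrthogonalEqBot]

lemma ext_on_Γ {S T : L2Cantor →L[ℂ] L2Cantor} (h : ∀ γ ∈ Γ, S (e γ) = T (e γ)) : S = T := by
  refine ContinuousLinearMap.ext_on
    (Submodule.dense_iff_topologicalClosure_eq_top.2 basisΓ.dense_span) ?_
  rintro _ ⟨γ, rfl⟩
  rw [basisΓ_apply]
  exact h γ γ.2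

end Spectrum

/-! ### The representation and its irreducibility. -/

section Representation

/-- The unitary operator that maps `e_γ` to `e_{5γ}` for `γ ∈ Γ`. -/
def scaleFive : L2Cantor ≃ₗᵢ[ℂ] L2Cantor := basisΓ.repr.trans basisFiveΓ.repr.symm

lemma scaleFive_e {γ : ℤ} (h : γ ∈ Γ) : scaleFive (e γ) = e (5 * γ) := by
  classical
  have h1 := basisΓ_apply ⟨γ, h⟩
  have h2 := basisFiveΓ_apply ⟨γ, h⟩
  simp only at h1 h2
  rw [← h1, ← h2, scaleFive, LinearIsometryEquiv.trans_apply, HilbertBasis.repr_self,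
    HilbertBasis.repr_symm_single]

lemma coe_mem_unitary (T : L2Cantor ≃ₗᵢ[ℂ] L2Cantor) :
    (T : L2Cantor →L[ℂ] L2Cantor) ∈ unitary (L2Cantor →L[ℂ] L2Cantor) :=
  (Unitary.linearIsometryEquiv.symm T).2

/-- The Cuntz isometries `f ↦ f ∘ σ` and `f ↦ e₁ · (f ∘ σ)`, where `σ` is the expansive map. -/
def cuntz : Fin 2 → (L2Cantor →ₗᵢ[ℂ] L2Cantor) :=
  ![compDilate, (mulExp ((1 : ℤ) : ℝ)).toLinearIsometry.comp compDilate]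

lemma cuntz_zero (f : L2Cantor) : cuntz 0 f = compDilate f := rfl

lemma cuntz_one (f : L2Cantor) : cuntz 1 f = mulExp ((1 : ℤ) : ℝ) (compDilate f) := rfl

lemma cuntz_zero_e (n : ℤ) : cuntz 0 (e n) = e (4 * n) := compDilate_e n

lemma cuntz_one_e (n : ℤ) : cuntz 1 (e n) = e (4 * n + 1) := by
  rw [cuntz_one, compDilate_e, mulExp_e, add_comm]

lemma inner_cuntz (i j : Fin 2) (f g : L2Cantor) :
    inner ℂ (cuntz i f) (cuntz j g) = if i = j then inner ℂ f g else 0 := by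
  fin_cases i <;> fin_cases j
  · exact (cuntz 0).inner_map_map f g
  · exact inner_compDilate_mulExp odd_one f g
  · exact inner_eq_zero_symm.1 (inner_compDilate_mulExp odd_one g f)
  · exact (cuntz 1).inner_map_map f g

lemma star_cuntz_cuntz (i j : Fin 2) (f : L2Cantor) :
    star (cuntz i).toContinuousLinearMap (cuntz j f) = if i = j then f else 0 := by
  refine ext_inner_left ℂ fun g => ?_
  rw [ContinuousLinearMap.star_eq_adjoint, ContinuousLinearMap.adjoint_inner_right,
    LinearIsometry.coe_toContinuousLinearMap, inner_cuntz]
  split_ifs <;> simp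

lemma sum_cuntz_star_cuntz (f : L2Cantor) (j : Fin 2) :
    (∑ i : Fin 2, (cuntz i).toContinuousLinearMap * star (cuntz i).toContinuousLinearMap)
      (cuntz j f) = cuntz j f := by
  rw [Fin.sum_univ_two, add_apply, mul_apply_eq_comp,
    mul_apply_eq_comp, star_cuntz_cuntz, star_cuntz_cuntz]
  fin_cases j <;> simp

/-- The representation on `L²(μ_{1/4})` of the Cuntz operators, the unitary `e_γ ↦ e_{5γ}` and
the multiplication by `e₁`. -/
def fractalRep : Rep L2Cantor where
  S i := (cuntz i).toContinuousLinearMap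
  U := scaleFive
  M := mulExp ((1 : ℤ) : ℝ)
  star_S_mul_S i j := by
    ext1 f
    refine (star_cuntz_cuntz i j f).trans ?_
    split_ifs <;> rfl
  sum_S_mul_star_S := by
    refine ext_on_Γ fun γ hγ => ?_
    -- Every basis vector lies in the range of one of the two isometries.
    obtain ⟨δ, hδ, rfl | rfl⟩ := mem_Γ_iff.1 hγ
    · rw [← cuntz_zero_e, sum_cuntz_star_cuntz, one_apply_eq_self]
    · rw [← cuntz_one_e, sum_cuntz_star_cuntz, one_apply_eq_self]
  isStarNormal_U := by
    have h := Unitary.mem_iff.1 (coe_mem_unitary scaleFive)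
    exact ⟨h.1.trans h.2.symm⟩
  unitary_M := coe_mem_unitary _
  star_S_one_mul_U_mul_S_one := by
    refine ext_on_Γ fun γ hγ => ?_
    change star (cuntz 1).toContinuousLinearMap (scaleFive (cuntz 1 (e γ)))
      = mulExp ((1 : ℤ) : ℝ) (scaleFive (e γ))
    -- The frequency `1 + 5 * γ` need not lie in `Γ`; `cuntz_one_e` holds for all integers.
    rw [cuntz_one_e, scaleFive_e (four_mul_add_one_mem_Γ hγ), scaleFive_e hγ, mulExp_e,
      show 5 * (4 * γ + 1) = 4 * (1 + 5 * γ) + 1 by ring, ← cuntz_one_e, star_cuntz_cuntz,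
      if_pos rfl]
  commute_S_zero_U := by
    refine ext_on_Γ fun γ hγ => ?_
    change cuntz 0 (scaleFive (e γ)) = scaleFive (cuntz 0 (e γ))
    rw [cuntz_zero_e, scaleFive_e hγ, scaleFive_e (four_mul_mem_Γ hγ), cuntz_zero_e]
    congr 1; ring

/-- The expansive map is ergodic: the only fixed vectors of `compDilate` are the constants. -/
lemma eq_smul_of_compDilate_eq {f : L2Cantor} (hf : compDilate f = f) : ∃ c : ℂ, f = c • e 0 := by
  refine ⟨inner ℂ (e 0) f, ?_⟩
  rw [← sub_eq_zero]
  set g := f - (inner ℂ (e 0) f : ℂ) • e 0 with hg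
  have hg0 : inner ℂ (e 0) g = 0 := by
    rw [hg, inner_sub_right, inner_smul_right, inner_self_eq_norm_sq_to_K, norm_e]
    simp
  have hgf : compDilate g = g := by
    rw [hg, map_sub, map_smul, hf, compDilate_e, mul_zero]
  -- Since `g` is fixed, its coefficient at `4 * δ` equals the one at `δ`, and the one at `4 * δ +
  -- 1` vanishes by orthogonality of the ranges.
  have main : ∀ N : ℕ, ∀ γ ∈ Γ, γ ≤ N → inner ℂ (e γ) g = 0 := by
    intro N
    induction N with
    | zero =>
      intro γ hγ hN
      have := nonneg_of_mem_Γ hγ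
      push_cast at hN
      rwa [show γ = 0 by omega]
    | succ N ih =>
      intro γ hγ hN
      obtain ⟨δ, hδ, rfl | rfl⟩ := mem_Γ_iff.1 hγ
      · have := nonneg_of_mem_Γ hδ
        push_cast at hN
        rw [← hgf, ← compDilate_e, LinearIsometry.inner_map_map]
        exact ih δ hδ (by omega)
      · rw [← hgf, ← cuntz_one_e, ← cuntz_zero, inner_cuntz, if_neg (by decide)]
  have hmem : g ∈ (spectralSpan 1)ᗮ := mem_spectralSpan_orthogonal_iff.2 fun γ hγ => by
    rw [one_mul]
    exact main γ.toNat γ hγ (Int.self_le_toNat γ)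
  rw [spectralSpan, Submodule.orthogonal_closure, orthogonal_span_e_eq_bot (Or.inl rfl)] at hmem
  exact hmem

lemma natCast_mem_of_mulExp_invariant {K : Submodule ℂ L2Cantor}
    (hM : ∀ f ∈ K, mulExp ((1 : ℤ) : ℝ) f ∈ K) (h0 : e 0 ∈ K) (n : ℕ) : e n ∈ K := by
  induction n with
  | zero => exact h0
  | succ n ih =>
    have := hM _ ih
    rwa [mulExp_e, add_comm] at this

lemma eq_top_of_mulExp_invariant {K : Submodule ℂ L2Cantor} (hK : IsClosed (K : Set L2Cantor))
    (hM : ∀ f ∈ K, mulExp ((1 : ℤ) : ℝ) f ∈ K) (h0 : e 0 ∈ K) : K = ⊤ := by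
  rw [eq_top_iff, ← basisΓ.dense_span]
  refine Submodule.topologicalClosure_minimal _ (Submodule.span_le.2 ?_) hK
  rintro _ ⟨γ, rfl⟩
  rw [basisΓ_apply, ← Int.toNat_of_nonneg (nonneg_of_mem_Γ γ.2)]
  exact natCast_mem_of_mulExp_invariant hM h0 _

lemma map_mem_orthogonal_of_star {K : Submodule ℂ L2Cantor} {T : L2Cantor →L[ℂ] L2Cantor}
    (hT : ∀ f ∈ K, star T f ∈ K) {g : L2Cantor} (hg : g ∈ Kᗮ) : T g ∈ Kᗮ := by
  rw [Submodule.mem_orthogonal] at hg ⊢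
  intro f hf
  rw [← ContinuousLinearMap.adjoint_inner_left]
  exact hg _ (hT f hf)

lemma isIrreducible_fractalRep : fractalRep.IsIrreducible := by
  refine ⟨⟨⟨e 0, 0, fun h => ?_⟩⟩, fun K hK hinv => ?_⟩
  · have := norm_e 0
    rw [h, norm_zero] at this
    exact zero_ne_one this
  have hS := hinv (fractalRep.S 0) (by simp [Rep.generators])
  have hM := hinv fractalRep.M (by simp [Rep.generators])
  have : CompleteSpace K := hK.completeSpace_coe
  set v := K.starProjection (e 0) with hv
  have hvK : v ∈ K := K.starProjection_apply_mem _
  have hvK' : e 0 - v ∈ Kᗮ := K.sub_starProjection_mem_orthogonal _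
  -- Apply `S₀` to `e 0 = v + (e 0 - v)`: `e 0` is fixed and both `K` and `Kᗮ` are preserved, so
  -- uniqueness of the decomposition applies.
  have hfix : compDilate v = v := by
    refine (Submodule.eq_starProjection_of_mem_orthogonal (K := K) (hS v hvK).1 ?_).symm
    have h := map_mem_orthogonal_of_star (fun f hf => (hS f hf).2) hvK'
    have h2 : fractalRep.S 0 (e 0 - v) = e 0 - compDilate v := by
      change compDilate (e 0 - v) = _
      rw [map_sub, compDilate_e, mul_zero]
    rwa [h2] at h
  obtain ⟨c, hc⟩ := eq_smul_of_compDilate_eq hfix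
  by_cases hc0 : c = 0
  · left
    rw [hc, hc0, zero_smul, sub_zero] at hvK'
    have h := eq_top_of_mulExp_invariant K.isClosed_orthogonal
      (fun f hf => map_mem_orthogonal_of_star (fun f hf => (hM f hf).2) hf) hvK'
    exact (Submodule.orthogonal_eq_top_iff K).1 h
  · right
    rw [hc] at hvK
    exact eq_top_of_mulExp_invariant hK (fun f hf => (hM f hf).1)
      ((K.smul_mem_iff hc0).1 hvK)

end Representation

end OperatorFractal

end

theorem theorem1p1 :
    ∃ π : OperatorFractal.Rep OperatorFractal.L2Cantor,
      (∀ γ ∈ OperatorFractal.Γ,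
        π.S 0 (OperatorFractal.e γ) = OperatorFractal.e (4 * γ) ∧
        π.S 1 (OperatorFractal.e γ) = OperatorFractal.e (4 * γ + 1) ∧
        π.U (OperatorFractal.e γ) = OperatorFractal.e (5 * γ)) ∧
      π.U ∈ unitary (OperatorFractal.L2Cantor →L[ℂ] OperatorFractal.L2Cantor) ∧
      (∀ f : OperatorFractal.L2Cantor,
        ⇑(π.M f) =ᵐ[OperatorFractal.cantorMeasure]
          fun t => OperatorFractal.expFun 1 t * f t) ∧
      π.IsIrreducible := by
  refine ⟨OperatorFractal.fractalRep, fun γ hγ => ⟨OperatorFractal.cuntz_zero_e γ,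
    OperatorFractal.cuntz_one_e γ, OperatorFractal.scaleFive_e hγ⟩,
    OperatorFractal.coe_mem_unitary _, fun f => ?_, OperatorFractal.isIrreducible_fractalRep⟩
  rw [← OperatorFractal.expFunR_intCast]
  exact OperatorFractal.coeFn_mulExp _ f
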